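/- **Definitions.** A *gm-space* is a triple $\mathbb X=(X,g,\xi)$ of a Polish space $X$, a Borel probability measure $\xi$ on $X$ and a *gauge* $g\in L^2_{\mathrm{sym}}(X\times X,\xi\otimes\xi)$ (real-valued, square integrable, symmetric). For gm-spaces $\mathbb X=(X,g,\xi)$, $\mathbb Y=(Y,h,\upsilon)$ let $\Pi(\mathbb X,\mathbb Y)$ be the set of Borel probability measures on $X\times Y$ with marginals $\xi,\upsilon$, let $$\mathrm{GW}(\mathbb X,\mathbb Y)=\inf_{\pi\in\Pi(\mathbb X,\mathbb Y)}\Bigl(\iint |g(x,x')-h(y,y')|^2\,d\pi(x,y)\,d\pi(x',y')\Bigr)^{1/2},$$ and let $\Pi_{\mathrm o}(\mathbb X,\mathbb Y)$ be the set of minimizers. Write $\mathbb X\simeq\mathbb Y$ if $\mathrm{GW}(\mathbb X,\mathbb Y)=0$, and $\llbracket\mathbb X\rrbracket$ for the class of $\mathbb X$. The *tangent space* $\mathfrak T_{\mathfrak Y}$ at a class $\mathfrak Y$ consists of the gauges $f|_{\mathbb Y}$, $f\in L^2_{\mathrm{sym}}(Y\times Y,\upsilon\otimes\upsilon)$, on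 all representatives $\mathbb Y=(Y,h,\upsilon)\in\mathfrak Y$, modulo the relation $f|_{\mathbb Y}\simeq\tilde f|_{\tilde{\mathbb Y}}$ iff there is $\tau\in\Pi_{\mathrm o}(\mathbb Y,\tilde{\mathbb Y})$ with $f(y,y')=\tilde f(\tilde y,\tilde y')$ for $\tau\otimes\tau$-a.e. $((y,\tilde y),(y',\tilde y'))$. Its metric is $$d_{\mathfrak T_{\mathfrak Y}}(\llbracket f|_{\mathbb Y}\rrbracket,\llbracket\tilde f|_{\tilde{\mathbb Y}}\rrbracket)=\inf_{\tau\in\Pi_{\mathrm o}(\mathbb Y,\tilde{\mathbb Y})}\Bigl(\iint|f(y,y')-\tilde f(\tilde y,\tilde y')|^2\,d\tau(y,\tilde y)\,d\tau(y',\tilde y')\Bigr)^{1/2}.$$ Two plans $\pi,\pi^*\in\Pi_{\mathrm o}(\mathbb Y,\mathbb X)$ are *equivalent with respect to $\mathbb Y$*, $\pi^*\simeq_{\mathbb Y}\pi$, if there are $\sigma\in\Pi_{\mathrm o}(\mathbb Y,\mathbb Y)$ and a Borel probability measure $\gamma$ on $Y\times Y\times X$ whose marginal on the first and second factor is $\sigma$,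 on the first and third factor is $\pi$, and on the second and third factor is $\pi^*$. **Theorem.** Let $\mathbb Y=(Y,h,\upsilon)$ and $\mathbb X_i=(X_i,g_i,\xi_i)$, $i=1,\dots,N$, be gm-spaces, let $\rho_1,\dots,\rho_N\ge 0$ with $\sum_i\rho_i=1$, and let $\pi_i\in\Pi_{\mathrm o}(\mathbb Y,\mathbb X_i)$. Put $\mathfrak Y=\llbracket\mathbb Y\rrbracket$, $X_\times=X_1\times\dots\times X_N$, $m_\rho(x,x')=\sum_{i=1}^N\rho_i g_i(x_i,x_i')$ for $x,x'\in X_\times$, and $$\mathfrak g_i=\llbracket(g_i-h)|_{(Y\times X_i,\,h,\,\pi_i)}\rrbracket\in\mathfrak T_{\mathfrak Y}$$ (gauges on a factor are regarded as functions on products via the projection). Then the tangential barycenter problem $$\inf_{\mathfrak f\in\mathfrak T_{\mathfrak Y}}\ \sum_{i=1}^N\rho_i\,d_{\mathfrak T_{\mathfrak Y}}^2(\mathfrak g_i,\mathfrak f)$$ admits a solution. Moreover, there exist plans $\pi_i^*\simeq_{\mathbb Y}\pi_i$, $i=1,\dots,N$, and a Borel probability measure $\gamma^*$ on $Y\times X_\times$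 with marginal $\pi_i^*$ on $Y\times X_i$ for every $i$ (a gluing of $\pi_1^*,\dots,\pi_N^*$ along $\mathbb Y$) such that $$\mathfrak m_\rho=\llbracket(m_\rho-h)|_{(Y\times X_\times,\,h,\,\gamma^*)}\rrbracket$$ is a solution of this problem. -/

import Mathlib

universe u

open MeasureTheory ProbabilityTheory
open scoped ENNReal

namespace GromovWasserstein

noncomputable section

section Gauges

variable {X Y : Type*} [MeasurableSpace X] [MeasurableSpace Y]

/-- The pull back `Ψ^# g` of a kernel `g` on `X × X` through `Ψ : Y → X`. -/
def pull {X Y : Type*} (Ψ : Y → X) (g : X × X → ℝ) : Y × Y → ℝ :=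
  fun p => g (Ψ p.1, Ψ p.2)

/-- `g` is (a representative of) an element of `L²_sym(X × X, ξ ⊗ ξ)`. -/
structure IsGauge (g : X × X → ℝ) (ξ : Measure X) : Prop where
  memLp : MemLp g 2 (ξ.prod ξ)
  symm : ∀ᵐ p ∂(ξ.prod ξ), g p.swap = g p

theorem measurePreserving_pair {ζ : Measure Y} {ξ : Measure X} [SFinite ζ] [SFinite ξ]
    {Φ : Y → X} (hΦ : MeasurePreserving Φ ζ ξ) :
    MeasurePreserving (fun p : Y × Y => (Φ p.1, Φ p.2)) (ζ.prod ζ) (ξ.prod ξ) :=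
  hΦ.prod hΦ

theorem IsGauge.pull {ζ : Measure Y} {ξ : Measure X} [SFinite ζ] [SFinite ξ]
    {Φ : Y → X} (hΦ : MeasurePreserving Φ ζ ξ) {g : X × X → ℝ} (hg : IsGauge g ξ) :
    IsGauge (pull Φ g) ζ where
  memLp := hg.memLp.comp_measurePreserving (measurePreserving_pair hΦ)
  symm := (measurePreserving_pair hΦ).quasiMeasurePreserving.ae hg.symm

theorem IsGauge.sub {ξ : Measure X} {g h : X × X → ℝ} (hg : IsGauge g ξ) (hh : IsGauge h ξ) :
    IsGauge (g - h) ξ where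
  memLp := hg.memLp.sub hh.memLp
  symm := by
    filter_upwards [hg.symm, hh.symm] with p h1 h2
    simp [h1, h2]

theorem IsGauge.weightedSum {ξ : Measure X} {N : ℕ} (ρ : Fin N → ℝ) {g : Fin N → X × X → ℝ}
    (hg : ∀ i, IsGauge (g i) ξ) : IsGauge (fun p => ∑ i, ρ i * g i p) ξ where
  memLp := memLp_finsetSum _ fun i _ => (hg i).memLp.const_mul (ρ i)
  symm := by
    filter_upwards [ae_all_iff.2 fun i => (hg i).symm] with p hp
    simp [hp]

/-- `‖f(·₁,·₃) - f'(·₂,·₄)‖_{L²(τ(·₁,·₂) ⊗ τ(·₃,·₄))}`, with values in `[0, ∞]`. -/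
def discrepancy (f : X × X → ℝ) (f' : Y × Y → ℝ) (τ : Measure (X × Y)) : ℝ≥0∞ :=
  eLpNorm (fun p : (X × Y) × (X × Y) => f (p.1.1, p.2.1) - f' (p.1.2, p.2.2)) 2 (τ.prod τ)

end Gauges

/-- A gauged measure space `(X, g, ξ)`. -/
structure GMSpace where
  carrier : Type u
  [top : TopologicalSpace carrier]
  [polish : PolishSpace carrier]
  [meas : MeasurableSpace carrier]
  [borel : BorelSpace carrier]
  gauge : carrier × carrier → ℝ
  measure : Measure carrier
  [prob : IsProbabilityMeasure measure]
  isGauge : IsGauge gauge measure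

instance : CoeSort GMSpace.{u} (Type u) := ⟨GMSpace.carrier⟩

attribute [instance] GMSpace.top GMSpace.polish GMSpace.meas GMSpace.borel GMSpace.prob

/-- `π ∈ Π(𝕏, 𝕐)`: a Borel probability measure on `X × Y` with marginals `ξ` and `υ`. -/
structure IsPlan (X Y : GMSpace.{u}) (π : Measure (X × Y)) : Prop where
  prob : IsProbabilityMeasure π
  fst : π.map Prod.fst = X.measure
  snd : π.map Prod.snd = Y.measure

/-- The Gromov–Wasserstein functional of a plan. -/
def gwFunctional (X Y : GMSpace.{u}) (π : Measure (X × Y)) : ℝ≥0∞ :=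
  discrepancy X.gauge Y.gauge π

/-- The Gromov–Wasserstein distance `GW₂(𝕏, 𝕐)`. -/
def gwDist (X Y : GMSpace.{u}) : ℝ≥0∞ :=
  ⨅ π : {π : Measure (X × Y) // IsPlan X Y π}, gwFunctional X Y π.1

/-- `π ∈ Π_o(𝕏, 𝕐)`: the plan `π` attains the Gromov–Wasserstein distance. -/
structure IsOptimal (X Y : GMSpace.{u}) (π : Measure (X × Y)) : Prop where
  isPlan : IsPlan X Y π
  eq_gwDist : gwFunctional X Y π = gwDist X Y

/-- `γ ∈ Γ_𝕏(π₁, π₂)`: a gluing of `π₁ ∈ Π(𝕏, 𝕐)` and `π₂ ∈ Π(𝕏, 𝕎)` along `𝕏`, where `𝕎` is the third space. -/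
structure IsGluing₂ (X Y Z : GMSpace.{u}) (π₁ : Measure (X × Y)) (π₂ : Measure (X × Z))
    (γ : Measure (X × Y × Z)) : Prop where
  prob : IsProbabilityMeasure γ
  left : γ.map (fun p => (p.1, p.2.1)) = π₁
  right : γ.map (fun p => (p.1, p.2.2)) = π₂

/-- The set `M_𝕏(π₁, π₂)` of meltings of `π₁` and `π₂` along `𝕏`. -/
def meltings (X Y Z : GMSpace.{u}) (π₁ : Measure (X × Y)) (π₂ : Measure (X × Z)) :
    Set (Measure (Y × Z)) :=
  {π | ∃ γ, IsGluing₂ X Y Z π₁ π₂ γ ∧ π = γ.map Prod.snd}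

/-- `π₁ ≃_𝕏 π₂`: two optimal plans that arise from each other by melting with an optimal
self-coupling of `𝕏`. -/
structure PlanEquiv (X Y : GMSpace.{u}) (π₁ π₂ : Measure (X × Y)) : Prop where
  left : IsOptimal X Y π₁
  right : IsOptimal X Y π₂
  melt : ∃ σ : Measure (X × X), IsOptimal X X σ ∧ π₁ ∈ meltings X X Y σ π₂

/-- `γ ∈ Γ_𝕐(π₁, …, π_N)`: a multi-marginal gluing along `𝕐`. The condition `fst` is implied by
the others if `N ≥ 1` and the `π_i` are plans. -/
structure IsGluing {N : ℕ} (Y : GMSpace.{u}) (X : Fin N → GMSpace.{u})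
    (π : ∀ i, Measure (Y × X i)) (γ : Measure (Y × (∀ i, X i))) : Prop where
  prob : IsProbabilityMeasure γ
  fst : γ.map Prod.fst = Y.measure
  marginal : ∀ i, γ.map (fun p => (p.1, p.2 i)) = π i

section Plans

variable {X Y Z : GMSpace.{u}}

theorem IsPlan.mp_fst {π : Measure (X × Y)} (h : IsPlan X Y π) :
    MeasurePreserving Prod.fst π X.measure := ⟨measurable_fst, h.fst⟩

theorem IsPlan.mp_snd {π : Measure (X × Y)} (h : IsPlan X Y π) :
    MeasurePreserving Prod.snd π Y.measure := ⟨measurable_snd, h.snd⟩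

theorem IsPlan.diag (X : GMSpace.{u}) : IsPlan X X (X.measure.map fun x => (x, x)) where
  prob := Measure.isProbabilityMeasure_map (by fun_prop)
  fst := by
    rw [Measure.map_map (by fun_prop) (by fun_prop)]
    exact Measure.map_id
  snd := by
    rw [Measure.map_map (by fun_prop) (by fun_prop)]
    exact Measure.map_id

theorem IsPlan.swap {π : Measure (X × Y)} (h : IsPlan X Y π) : IsPlan Y X (π.map Prod.swap) where
  prob := by
    have := h.prob
    exact Measure.isProbabilityMeasure_map (by fun_prop)
  fst := by
    rw [Measure.map_map (by fun_prop) (by fun_prop)]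
    exact h.snd
  snd := by
    rw [Measure.map_map (by fun_prop) (by fun_prop)]
    exact h.fst

theorem aesm_discrepancy {π : Measure (X × Y)} (h : IsPlan X Y π) {f : X × X → ℝ} {f' : Y × Y → ℝ}
    (hf : IsGauge f X.measure) (hf' : IsGauge f' Y.measure) :
    AEStronglyMeasurable
      (fun p : (X × Y) × (X × Y) => f (p.1.1, p.2.1) - f' (p.1.2, p.2.2)) (π.prod π) := by
  have := h.prob
  exact (hf.pull h.mp_fst).memLp.1.sub (hf'.pull h.mp_snd).memLp.1

theorem discrepancy_map {W : Type*} [MeasurableSpace W] {ω : Measure W} [IsProbabilityMeasure ω]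
    {a : W → X} {b : W → Y} (ha : Measurable a) (hb : Measurable b)
    (h : IsPlan X Y (ω.map fun w => (a w, b w))) {f : X × X → ℝ} {f' : Y × Y → ℝ}
    (hf : IsGauge f X.measure) (hf' : IsGauge f' Y.measure) :
    discrepancy f f' (ω.map fun w => (a w, b w)) =
      eLpNorm (fun p : W × W => f (a p.1, a p.2) - f' (b p.1, b p.2)) 2 (ω.prod ω) := by
  have := h.prob
  have hm : MeasurePreserving (fun w => (a w, b w)) ω (ω.map fun w => (a w, b w)) :=
    ⟨by fun_prop, rfl⟩
  exact (eLpNorm_comp_measurePreserving (aesm_discrepancy h hf hf')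
    (measurePreserving_pair hm)).symm

theorem discrepancy_diag {f : X × X → ℝ} (hf : IsGauge f X.measure) :
    discrepancy f f (X.measure.map fun x => (x, x)) = 0 := by
  rw [discrepancy_map (a := fun x => x) (b := fun x => x) measurable_id measurable_id
    (IsPlan.diag X) hf hf]
  simp

theorem discrepancy_swap {π : Measure (X × Y)} (h : IsPlan X Y π) {f : X × X → ℝ}
    {f' : Y × Y → ℝ} (hf : IsGauge f X.measure) (hf' : IsGauge f' Y.measure) :
    discrepancy f' f (π.map Prod.swap) = discrepancy f f' π := by
  have := h.prob
  refine (discrepancy_map (a := Prod.snd) (b := Prod.fst) measurable_snd measurable_fst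
    h.swap hf' hf).trans ?_
  exact eLpNorm_sub_comm _ _ _ _

theorem discrepancy_eq_zero_iff {π : Measure (X × Y)} (h : IsPlan X Y π) {f : X × X → ℝ}
    {f' : Y × Y → ℝ} (hf : IsGauge f X.measure) (hf' : IsGauge f' Y.measure) :
    discrepancy f f' π = 0 ↔
      ∀ᵐ p ∂(π.prod π), f (p.1.1, p.2.1) = f' (p.1.2, p.2.2) := by
  rw [discrepancy, eLpNorm_eq_zero_iff (aesm_discrepancy h hf hf') (by norm_num)]
  simp only [Filter.EventuallyEq, Pi.zero_apply, sub_eq_zero]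

/-- Gluing: two plans with a common middle space compose, and all discrepancies satisfy the
triangle inequality along the composition. -/
theorem exists_comp {π₁ : Measure (X × Y)} {π₂ : Measure (Y × Z)} (h₁ : IsPlan X Y π₁)
    (h₂ : IsPlan Y Z π₂) : ∃ π : Measure (X × Z), IsPlan X Z π ∧
      ∀ (a : X × X → ℝ) (b : Y × Y → ℝ) (c : Z × Z → ℝ), IsGauge a X.measure →
        IsGauge b Y.measure → IsGauge c Z.measure →
        discrepancy a c π ≤ discrepancy a b π₁ + discrepancy b c π₂ := by
  have := h₁.swap.prob
  have := h₁.prob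
  have := h₂.prob
  have : Nonempty X := X.measure.nonempty_of_neZero
  have : Nonempty Z := Z.measure.nonempty_of_neZero
  set κ₁ := (π₁.map Prod.swap).condKernel with hκ₁
  set κ₂ := π₂.condKernel with hκ₂
  set ω : Measure (Y × X × Z) := Y.measure ⊗ₘ (κ₁ ×ₖ κ₂) with hω
  have e₁ : Y.measure ⊗ₘ κ₁ = π₁.map Prod.swap := by
    have h : (π₁.map Prod.swap).fst = Y.measure := h₁.swap.fst
    rw [← h]; exact Measure.disintegrate _ _
  have e₂ : Y.measure ⊗ₘ κ₂ = π₂ := by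
    have h : π₂.fst = Y.measure := h₂.fst
    rw [← h]; exact Measure.disintegrate _ _
  have m₁ : ω.map (fun p => (p.1, p.2.1)) = π₁.map Prod.swap := by
    rw [← e₁, ← Kernel.fst_prod κ₁ κ₂, Kernel.fst_eq, Measure.compProd_map measurable_fst]
    rfl
  have m₂ : ω.map (fun p => (p.1, p.2.2)) = π₂ := by
    rw [← e₂, ← Kernel.snd_prod κ₁ κ₂, Kernel.snd_eq, Measure.compProd_map measurable_snd]
    rfl
  have m₁' : ω.map (fun p => (p.2.1, p.1)) = π₁ := by
    have := congrArg (Measure.map Prod.swap) m₁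
    rw [Measure.map_map (by fun_prop) (by fun_prop),
      Measure.map_map (by fun_prop) (by fun_prop)] at this
    refine Eq.trans ?_ (this.trans ?_)
    · rfl
    · rw [Prod.swap_swap_eq, Measure.map_id]
  have hp : IsPlan X Z (ω.map fun p => (p.2.1, p.2.2)) := by
    refine ⟨Measure.isProbabilityMeasure_map (by fun_prop), ?_, ?_⟩
    · rw [← h₁.fst, ← m₁', Measure.map_map (by fun_prop) (by fun_prop),
        Measure.map_map (by fun_prop) (by fun_prop)]
      rfl
    · rw [← h₂.snd, ← m₂, Measure.map_map (by fun_prop) (by fun_prop),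
        Measure.map_map (by fun_prop) (by fun_prop)]
      rfl
  refine ⟨_, hp, fun a b c ha hb hc => ?_⟩
  have d₁ := discrepancy_map (ω := ω) (a := fun p => p.2.1) (b := fun p => p.1) (by fun_prop)
    (by fun_prop) (by rw [m₁']; exact h₁) ha hb
  have d₂ := discrepancy_map (ω := ω) (a := fun p => p.1) (b := fun p => p.2.2) (by fun_prop)
    (by fun_prop) (by rw [m₂]; exact h₂) hb hc
  rw [m₁'] at d₁
  rw [m₂] at d₂
  rw [discrepancy_map (by fun_prop) (by fun_prop) hp ha hc, d₁, d₂]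
  have pX : MeasurePreserving (fun p : Y × X × Z => p.2.1) ω X.measure :=
    ⟨by fun_prop, by
      rw [← h₁.fst, ← m₁', Measure.map_map (by fun_prop) (by fun_prop)]; rfl⟩
  have pY : MeasurePreserving (fun p : Y × X × Z => p.1) ω Y.measure :=
    ⟨by fun_prop, by
      rw [← h₂.fst, ← m₂, Measure.map_map (by fun_prop) (by fun_prop)]; rfl⟩
  have pZ : MeasurePreserving (fun p : Y × X × Z => p.2.2) ω Z.measure :=
    ⟨by fun_prop, by
      rw [← h₂.snd, ← m₂, Measure.map_map (by fun_prop) (by fun_prop)]; rfl⟩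
  have key := eLpNorm_add_le (μ := ω.prod ω) (p := 2)
    ((ha.pull pX).memLp.1.sub (hb.pull pY).memLp.1)
    ((hb.pull pY).memLp.1.sub (hc.pull pZ).memLp.1) (by norm_num)
  rw [sub_add_sub_cancel] at key
  exact key

theorem gwDist_le {π : Measure (X × Y)} (h : IsPlan X Y π) :
    gwDist X Y ≤ discrepancy X.gauge Y.gauge π :=
  iInf_le (fun π : {π : Measure (X × Y) // IsPlan X Y π} => gwFunctional X Y π.1) ⟨π, h⟩

theorem gwDist_self (X : GMSpace.{u}) : gwDist X X = 0 := by
  refine le_antisymm ?_ bot_le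
  rw [← discrepancy_diag X.isGauge]
  exact gwDist_le (IsPlan.diag X)

theorem gwDist_le_swap (X Y : GMSpace.{u}) : gwDist Y X ≤ gwDist X Y := by
  refine le_iInf fun π => ?_
  rw [gwFunctional, ← discrepancy_swap π.2 X.isGauge Y.isGauge]
  exact gwDist_le π.2.swap

theorem gwDist_comm (X Y : GMSpace.{u}) : gwDist X Y = gwDist Y X :=
  le_antisymm (gwDist_le_swap _ _) (gwDist_le_swap _ _)

theorem gwDist_triangle (X Y Z : GMSpace.{u}) : gwDist X Z ≤ gwDist X Y + gwDist Y Z := by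
  conv_rhs => rw [gwDist, gwDist, ENNReal.iInf_add]
  refine le_iInf fun π₁ => ?_
  rw [ENNReal.add_iInf]
  refine le_iInf fun π₂ => ?_
  obtain ⟨π, hπ, h⟩ := exists_comp π₁.2 π₂.2
  exact (gwDist_le hπ).trans (h _ _ _ X.isGauge Y.isGauge Z.isGauge)

end Plans

/-- Homomorphy `𝕏 ≃ 𝕐`, i.e. `GW(𝕏, 𝕐) = 0`. -/
instance homSetoid : Setoid GMSpace.{u} where
  r X Y := gwDist X Y = 0
  iseqv :=
    { refl := gwDist_self
      symm := fun {X Y} h => (gwDist_comm Y X).trans h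
      trans := fun {X Y Z} h₁ h₂ => by
        have := gwDist_triangle X Y Z
        rw [h₁, h₂, add_zero] at this
        exact le_antisymm this bot_le }

/-- The space `𝔊𝔐` of homomorphic classes of gauged measure spaces. -/
def GMClass : Type (u + 1) := Quotient homSetoid.{u}

/-- The homomorphic class `⟦𝕏⟧`. -/
def GMSpace.toClass (X : GMSpace.{u}) : GMClass.{u} := Quotient.mk homSetoid X

theorem toClass_eq_iff {X Y : GMSpace.{u}} : X.toClass = Y.toClass ↔ gwDist X Y = 0 :=
  Quotient.eq

/-- An element `f|_𝕐` of the disjoint union of the gauge spaces `L²_sym(Y × Y, υ ⊗ υ)` over all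
representatives `𝕐 = (Y, h, υ)` of the class `𝔜`. -/
structure TangentRep (𝔜 : GMClass.{u}) where
  base : GMSpace.{u}
  base_mem : base.toClass = 𝔜
  toFun : base × base → ℝ
  isGauge : IsGauge toFun base.measure

namespace TangentRep

variable {𝔜 : GMClass.{u}}

/-- `f ≃ f'`: the two gauges agree almost everywhere along some optimal plan of their bases. -/
def Equivalent (f f' : TangentRep 𝔜) : Prop :=
  ∃ τ : Measure (f.base × f'.base), IsOptimal f.base f'.base τ ∧
    ∀ᵐ p ∂(τ.prod τ), f.toFun (p.1.1, p.2.1) = f'.toFun (p.1.2, p.2.2)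

/-- The tangent metric on representatives. -/
def dist (f f' : TangentRep 𝔜) : ℝ≥0∞ :=
  ⨅ τ : {τ : Measure (f.base × f'.base) // IsOptimal f.base f'.base τ},
    discrepancy f.toFun f'.toFun τ.1

theorem gwDist_eq_zero (f f' : TangentRep 𝔜) : gwDist f.base f'.base = 0 :=
  toClass_eq_iff.1 (f.base_mem.trans f'.base_mem.symm)

theorem isOptimal_iff (f f' : TangentRep 𝔜) {τ : Measure (f.base × f'.base)} :
    IsOptimal f.base f'.base τ ↔
      IsPlan f.base f'.base τ ∧ discrepancy f.base.gauge f'.base.gauge τ = 0 := by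
  rw [← gwDist_eq_zero f f']
  exact ⟨fun h => ⟨h.1, h.2⟩, fun h => ⟨h.1, h.2⟩⟩

theorem exists_comp_optimal {f₁ f₂ f₃ : TangentRep 𝔜} {τ₁ : Measure (f₁.base × f₂.base)}
    {τ₂ : Measure (f₂.base × f₃.base)} (h₁ : IsOptimal f₁.base f₂.base τ₁)
    (h₂ : IsOptimal f₂.base f₃.base τ₂) :
    ∃ τ : Measure (f₁.base × f₃.base), IsOptimal f₁.base f₃.base τ ∧
      discrepancy f₁.toFun f₃.toFun τ ≤
        discrepancy f₁.toFun f₂.toFun τ₁ + discrepancy f₂.toFun f₃.toFun τ₂ := by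
  obtain ⟨τ, hτ, h⟩ := exists_comp h₁.1 h₂.1
  refine ⟨τ, (isOptimal_iff f₁ f₃).2 ⟨hτ, ?_⟩, h _ _ _ f₁.isGauge f₂.isGauge f₃.isGauge⟩
  have := h _ _ _ f₁.base.isGauge f₂.base.isGauge f₃.base.isGauge
  rw [((isOptimal_iff f₁ f₂).1 h₁).2, ((isOptimal_iff f₂ f₃).1 h₂).2, add_zero] at this
  exact le_antisymm this bot_le

theorem equivalent_iff {f f' : TangentRep 𝔜} : f.Equivalent f' ↔
    ∃ τ, IsOptimal f.base f'.base τ ∧ discrepancy f.toFun f'.toFun τ = 0 :=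
  exists_congr fun _ => and_congr_right fun h =>
    (discrepancy_eq_zero_iff h.1 f.isGauge f'.isGauge).symm

theorem Equivalent.refl (f : TangentRep 𝔜) : f.Equivalent f :=
  equivalent_iff.2 ⟨_, (isOptimal_iff f f).2 ⟨IsPlan.diag _, discrepancy_diag f.base.isGauge⟩,
    discrepancy_diag f.isGauge⟩

theorem Equivalent.symm {f f' : TangentRep 𝔜} (h : f.Equivalent f') : f'.Equivalent f := by
  obtain ⟨τ, hτ, h0⟩ := equivalent_iff.1 h
  refine equivalent_iff.2 ⟨τ.map Prod.swap, (isOptimal_iff f' f).2 ⟨hτ.1.swap, ?_⟩, ?_⟩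
  · rw [discrepancy_swap hτ.1 f.base.isGauge f'.base.isGauge]
    exact ((isOptimal_iff f f').1 hτ).2
  · rw [discrepancy_swap hτ.1 f.isGauge f'.isGauge, h0]

theorem Equivalent.trans {f₁ f₂ f₃ : TangentRep 𝔜} (h : f₁.Equivalent f₂)
    (h' : f₂.Equivalent f₃) : f₁.Equivalent f₃ := by
  obtain ⟨τ₁, hτ₁, h1⟩ := equivalent_iff.1 h
  obtain ⟨τ₂, hτ₂, h2⟩ := equivalent_iff.1 h'
  obtain ⟨τ, hτ, h3⟩ := exists_comp_optimal hτ₁ hτ₂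
  rw [h1, h2, add_zero] at h3
  exact equivalent_iff.2 ⟨τ, hτ, le_antisymm h3 bot_le⟩

theorem dist_le {f f' : TangentRep 𝔜} {τ : Measure (f.base × f'.base)}
    (h : IsOptimal f.base f'.base τ) : f.dist f' ≤ discrepancy f.toFun f'.toFun τ :=
  iInf_le (fun τ : {τ : Measure (f.base × f'.base) // IsOptimal f.base f'.base τ} =>
    discrepancy f.toFun f'.toFun τ.1) ⟨τ, h⟩

theorem dist_triangle (f₁ f₂ f₃ : TangentRep 𝔜) : f₁.dist f₃ ≤ f₁.dist f₂ + f₂.dist f₃ := by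
  conv_rhs => rw [dist, dist, ENNReal.iInf_add]
  refine le_iInf fun τ₁ => ?_
  rw [ENNReal.add_iInf]
  refine le_iInf fun τ₂ => ?_
  obtain ⟨τ, hτ, h⟩ := exists_comp_optimal τ₁.2 τ₂.2
  exact (dist_le hτ).trans h

theorem Equivalent.dist_eq_zero {f f' : TangentRep 𝔜} (h : f.Equivalent f') : f.dist f' = 0 := by
  obtain ⟨τ, hτ, h0⟩ := equivalent_iff.1 h
  refine le_antisymm ?_ bot_le
  rw [← h0]
  exact dist_le hτ

theorem Equivalent.dist_le {f₁ f₂ g₁ g₂ : TangentRep 𝔜} (h : f₁.Equivalent g₁)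
    (h' : f₂.Equivalent g₂) : f₁.dist f₂ ≤ g₁.dist g₂ := by
  calc f₁.dist f₂ ≤ f₁.dist g₁ + g₁.dist f₂ := dist_triangle _ _ _
    _ ≤ f₁.dist g₁ + (g₁.dist g₂ + g₂.dist f₂) := by gcongr; exact dist_triangle _ _ _
    _ = g₁.dist g₂ := by rw [h.dist_eq_zero, h'.symm.dist_eq_zero, zero_add, add_zero]

instance setoid (𝔜 : GMClass.{u}) : Setoid (TangentRep 𝔜) :=
  ⟨Equivalent, Equivalent.refl, Equivalent.symm, Equivalent.trans⟩

end TangentRep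

/-- The tangent space `𝔗_𝔜`. -/
def TangentSpace (𝔜 : GMClass.{u}) : Type (u + 1) := Quotient (TangentRep.setoid 𝔜)

/-- The class `⟦f|_𝕐⟧` in the tangent space. -/
def TangentRep.toTangent {𝔜 : GMClass.{u}} (f : TangentRep 𝔜) : TangentSpace 𝔜 :=
  Quotient.mk (TangentRep.setoid 𝔜) f

/-- The tangent metric `d_{𝔗_𝔜}`, with values in `[0, ∞]`. -/
def tangentDist {𝔜 : GMClass.{u}} : TangentSpace 𝔜 → TangentSpace 𝔜 → ℝ≥0∞ :=
  Quotient.lift₂ TangentRep.dist fun _ _ _ _ h h' =>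
    le_antisymm (TangentRep.Equivalent.dist_le h h')
      (TangentRep.Equivalent.dist_le (TangentRep.Equivalent.symm h)
        (TangentRep.Equivalent.symm h'))

/-- The gauged measure space `(Y × Z, h, γ)` for `𝕐 = (Y, h, υ)` and a probability measure `γ` on
`Y × Z` with first marginal `υ`; here `h` is pulled back from `Y`. -/
def GMSpace.over (Y : GMSpace.{u}) {Z : Type u} [TopologicalSpace Z] [PolishSpace Z]
    [MeasurableSpace Z] [BorelSpace Z] (γ : Measure (Y × Z)) (hp : IsProbabilityMeasure γ)
    (hγ : γ.map Prod.fst = Y.measure) : GMSpace.{u} where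
  carrier := Y × Z
  gauge := pull Prod.fst Y.gauge
  measure := γ
  isGauge := Y.isGauge.pull ⟨measurable_fst, hγ⟩

theorem GMSpace.over_toClass (Y : GMSpace.{u}) {Z : Type u} [TopologicalSpace Z] [PolishSpace Z]
    [MeasurableSpace Z] [BorelSpace Z] (γ : Measure (Y × Z)) (hp : IsProbabilityMeasure γ)
    (hγ : γ.map Prod.fst = Y.measure) : (Y.over γ hp hγ).toClass = Y.toClass := by
  have hm : Measurable (fun p : Y × Z => (p, p.1)) := by fun_prop
  have h : IsPlan (Y.over γ hp hγ) Y (γ.map fun p : Y × Z => (p, p.1)) := by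
    refine ⟨Measure.isProbabilityMeasure_map hm.aemeasurable, ?_, ?_⟩
    · exact (Measure.map_map measurable_fst hm).trans Measure.map_id
    · exact (Measure.map_map measurable_snd hm).trans hγ
  refine toClass_eq_iff.2 (le_antisymm ((gwDist_le h).trans (le_of_eq ?_)) bot_le)
  refine (discrepancy_map (W := Y × Z) (ω := γ) (X := Y.over γ hp hγ) (Y := Y)
    (a := fun p => p) (b := Prod.fst) measurable_id measurable_fst h
    (Y.over γ hp hγ).isGauge Y.isGauge).trans ?_
  have h0 : (fun p : (Y × Z) × (Y × Z) =>
      (Y.over γ hp hγ).gauge (p.1, p.2) - Y.gauge (p.1.1, p.2.1)) = 0 :=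
    funext fun p => sub_self (Y.gauge (p.1.1, p.2.1))
  exact (congrArg (fun F => eLpNorm F 2 (γ.prod γ)) h0).trans eLpNorm_zero

/-- The lifting `⟦(g - h)|_{(Y × X, h, π)}⟧` of `𝕏 = (X, g, ξ)` into the tangent space at
`𝕐 = (Y, h, υ)` along a plan `π`. -/
def lift (Y X : GMSpace.{u}) (π : Measure (Y × X)) (hπ : IsPlan Y X π) :
    TangentSpace Y.toClass :=
  TangentRep.toTangent
    { base := Y.over π hπ.prob hπ.fst
      base_mem := Y.over_toClass π hπ.prob hπ.fst
      toFun := pull Prod.snd X.gauge - pull Prod.fst Y.gauge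
      isGauge :=
        have := hπ.prob
        (X.isGauge.pull hπ.mp_snd).sub (Y.isGauge.pull hπ.mp_fst) }

/-- The mean gauge `m_ρ(x, x') = ∑ᵢ ρᵢ gᵢ(xᵢ, xᵢ')` on `X_× = X₁ × ⋯ × X_N`. -/
def meanGauge {N : ℕ} (X : Fin N → GMSpace.{u}) (ρ : Fin N → ℝ) :
    (∀ i, X i) × (∀ i, X i) → ℝ :=
  fun p => ∑ i, ρ i * (X i).gauge (p.1 i, p.2 i)

theorem IsGluing.mp_coord {N : ℕ} {Y : GMSpace.{u}} {X : Fin N → GMSpace.{u}}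
    {π : ∀ i, Measure (Y × X i)} {γ : Measure (Y × (∀ i, X i))} (hγ : IsGluing Y X π γ)
    (hπ : ∀ i, IsPlan Y (X i) (π i)) (i : Fin N) :
    MeasurePreserving (fun p : Y × (∀ i, X i) => p.2 i) γ (X i).measure := by
  refine ⟨by fun_prop, ?_⟩
  rw [← (hπ i).snd, ← hγ.marginal i, Measure.map_map (by fun_prop) (by fun_prop)]
  rfl

/-- The tangent `⟦(m_ρ - h)|_{(Y × X_×, h, γ)}⟧` for a gluing `γ` of plans `π_i ∈ Π(𝕐, 𝕏_i)`. -/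
def meanTangent {N : ℕ} (Y : GMSpace.{u}) (X : Fin N → GMSpace.{u}) (ρ : Fin N → ℝ)
    (π : ∀ i, Measure (Y × X i)) (hπ : ∀ i, IsPlan Y (X i) (π i))
    (γ : Measure (Y × (∀ i, X i))) (hγ : IsGluing Y X π γ) : TangentSpace Y.toClass :=
  TangentRep.toTangent
    { base := Y.over γ hγ.prob hγ.fst
      base_mem := Y.over_toClass γ hγ.prob hγ.fst
      toFun := pull Prod.snd (meanGauge X ρ) - pull Prod.fst Y.gauge
      isGauge :=
        have := hγ.prob
        (IsGauge.weightedSum ρ fun i => (X i).isGauge.pull (hγ.mp_coord hπ i)).sub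
          (Y.isGauge.pull ⟨measurable_fst, hγ.fst⟩) }

/-- The tangential barycenter loss `∑ᵢ ρᵢ d²(𝔤ᵢ, 𝔣)`, for weights `ρᵢ ≥ 0`. -/
def barycenterLoss {N : ℕ} {𝔜 : GMClass.{u}} (ρ : Fin N → ℝ) (𝔤 : Fin N → TangentSpace 𝔜)
    (𝔣 : TangentSpace 𝔜) : ℝ≥0∞ :=
  ∑ i, ENNReal.ofReal (ρ i) * tangentDist (𝔤 i) 𝔣 ^ 2

/-- The value of the tangential barycenter problem. -/
def barycenterValue {N : ℕ} {𝔜 : GMClass.{u}} (ρ : Fin N → ℝ) (𝔤 : Fin N → TangentSpace 𝔜) :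
    ℝ≥0∞ :=
  ⨅ 𝔣 : TangentSpace 𝔜, barycenterLoss ρ 𝔤 𝔣

/-- `𝔣` solves the tangential barycenter problem. -/
def IsTangentialBarycenter {N : ℕ} {𝔜 : GMClass.{u}} (ρ : Fin N → ℝ)
    (𝔤 : Fin N → TangentSpace 𝔜) (𝔣 : TangentSpace 𝔜) : Prop :=
  barycenterLoss ρ 𝔤 𝔣 = barycenterValue ρ 𝔤

end

end GromovWasserstein

open GromovWasserstein

/-!
Glue optimal plans from the tangents `𝔤ᵢ` to a competitor `𝔣` along the base of `𝔣`. Forgetting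
`𝔣` leaves a coupling of the bases of the `𝔤ᵢ` whose two-dimensional marginals are all optimal, and
since the weighted mean minimises `c ↦ ∑ᵢ ρᵢ (aᵢ - c)²`, the mean of the `𝔤ᵢ` along this coupling is
at least as good as `𝔣`. The problem thus reduces to minimising the weighted variance over the
pairwise optimal couplings. These form a weakly compact set, and the variance is continuous there
because `L²`-kernels with prescribed marginals are approximated by bounded continuous ones uniformly
in the coupling. As the base gauges agree along a pairwise optimal coupling of lifts, the
`Y`-components can be identified, which turns a minimal coupling into a gluing.
-/

namespace GromovWasserstein

open Filter Topology Set
open scoped BoundedContinuousFunction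

section Gluing

variable {ι W : Type*} [MeasurableSpace W] {Z : ι → Type*} [∀ i, MeasurableSpace (Z i)]

theorem measurable_measurePi [Fintype ι] (κ : ∀ i, Kernel W (Z i)) [∀ i, IsMarkovKernel (κ i)] :
    Measurable fun w => Measure.pi fun i => κ i w := by
  refine Measurable.measure_of_isPiSystem_of_isProbabilityMeasure generateFrom_pi.symm
    isPiSystem_pi ?_
  rintro _ ⟨s, hs, rfl⟩
  simp only [Measure.pi_pi]
  exact Finset.measurable_fun_prod _ fun i _ => (κ i).measurable_coe (hs i (mem_univ i))

/-- The kernel `w ↦ ⨂ᵢ κᵢ(w)` that makes the coordinates conditionally independent given `w`. -/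
noncomputable def piKernel [Fintype ι] (κ : ∀ i, Kernel W (Z i)) [∀ i, IsMarkovKernel (κ i)] :
    Kernel W (∀ i, Z i) :=
  ⟨fun w => Measure.pi fun i => κ i w, measurable_measurePi κ⟩

instance [Fintype ι] (κ : ∀ i, Kernel W (Z i)) [∀ i, IsMarkovKernel (κ i)] :
    IsMarkovKernel (piKernel κ) :=
  ⟨fun w => inferInstanceAs (IsProbabilityMeasure (Measure.pi fun i => κ i w))⟩

theorem map_eval_piKernel [Fintype ι] (κ : ∀ i, Kernel W (Z i)) [∀ i, IsMarkovKernel (κ i)]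
    (i : ι) : (piKernel κ).map (Function.eval i) = κ i := by
  ext1 w
  rw [Kernel.map_apply _ (measurable_pi_apply i)]
  exact (measurePreserving_eval (fun i => κ i w) i).map_eq

theorem exists_common_gluing [Finite ι] [∀ i, StandardBorelSpace (Z i)] {μ : Measure W}
    [SFinite μ] {τ : ∀ i, Measure (Z i × W)} [∀ i, IsProbabilityMeasure (τ i)]
    (hτ : ∀ i, (τ i).map Prod.snd = μ) :
    ∃ ω : Measure ((∀ i, Z i) × W), MeasurePreserving Prod.snd ω μ ∧
      ∀ i, MeasurePreserving (fun p => (p.1 i, p.2)) ω (τ i) := by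
  cases nonempty_fintype ι
  have (i : ι) : Nonempty (Z i) := (τ i).nonempty_of_neZero.map Prod.fst
  have (i : ι) : IsProbabilityMeasure ((τ i).map Prod.swap) :=
    Measure.isProbabilityMeasure_map (by fun_prop)
  let κ (i : ι) : Kernel W (Z i) := ((τ i).map Prod.swap).condKernel
  have hκ (i : ι) : μ ⊗ₘ κ i = (τ i).map Prod.swap := by
    rw [← hτ i, ← Measure.snd, ← Measure.fst_map_swap]
    exact Measure.disintegrate _ _
  have hswap : Measurable (Prod.swap : W × (∀ i, Z i) → _) := measurable_swap
  refine ⟨(μ ⊗ₘ piKernel κ).map Prod.swap, ⟨measurable_snd, ?_⟩, fun i => ⟨by fun_prop, ?_⟩⟩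
  · exact Measure.snd_map_swap.trans (Measure.fst_compProd μ (piKernel κ))
  calc ((μ ⊗ₘ piKernel κ).map Prod.swap).map (fun p => (p.1 i, p.2))
      = ((μ ⊗ₘ piKernel κ).map (Prod.map id (Function.eval i))).map Prod.swap := by
        rw [Measure.map_map (by fun_prop) hswap, Measure.map_map (by fun_prop) (by fun_prop)]
        rfl
    _ = ((τ i).map Prod.swap).map Prod.swap := by
        rw [← Measure.compProd_map (measurable_pi_apply i), map_eval_piKernel, hκ]
    _ = τ i := by
        rw [Measure.map_map measurable_swap measurable_swap, Prod.swap_swap_eq, Measure.map_id]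

end Gluing

section Compactness

theorem isClosed_setOf_measurePreserving {E Z : Type*} [TopologicalSpace E] [MeasurableSpace E]
    [OpensMeasurableSpace E] [TopologicalSpace Z] [PolishSpace Z] [MeasurableSpace Z]
    [BorelSpace Z] {φ : E → Z} (hφ : Continuous φ) (μ : Measure Z) [IsProbabilityMeasure μ] :
    IsClosed {P : ProbabilityMeasure E | MeasurePreserving φ (P : Measure E) μ} := by
  let := TopologicalSpace.upgradeIsCompletelyMetrizable Z
  have hset : {P : ProbabilityMeasure E | MeasurePreserving φ (P : Measure E) μ} =
      {P | P.map hφ.measurable.aemeasurable = ⟨μ, inferInstance⟩} := by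
    ext P
    exact ⟨fun h => Subtype.ext h.map_eq, fun h => ⟨hφ.measurable, congrArg Subtype.val h⟩⟩
  rw [hset]
  exact isClosed_eq (ProbabilityMeasure.continuous_map hφ) continuous_const

variable {ι : Type*} [Countable ι] {Z : ι → Type*} [∀ i, TopologicalSpace (Z i)]
  [∀ i, MeasurableSpace (Z i)]

theorem isTightMeasureSet_pi [∀ i, T2Space (Z i)] [∀ i, OpensMeasurableSpace (Z i)]
    {S : Set (Measure (∀ i, Z i))}
    (hS : ∀ i, IsTightMeasureSet ((fun μ => μ.map (Function.eval i)) '' S)) :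
    IsTightMeasureSet S := by
  rw [isTightMeasureSet_iff_exists_isCompact_measure_compl_le]
  intro ε hε
  obtain ⟨δ, hδ, hδε⟩ := ENNReal.exists_pos_sum_of_countable' hε.ne' ι
  choose K hK hKδ using fun i =>
    isTightMeasureSet_iff_exists_isCompact_measure_compl_le.1 (hS i) (δ i) (hδ i)
  refine ⟨univ.pi K, isCompact_univ_pi hK, fun μ hμ => ?_⟩
  have hcover : (univ.pi K)ᶜ ⊆ ⋃ i, Function.eval i ⁻¹' (K i)ᶜ := by
    intro z hz
    simpa [Set.mem_pi] using hz
  calc μ (univ.pi K)ᶜ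
      ≤ ∑' i, μ (Function.eval i ⁻¹' (K i)ᶜ) := (measure_mono hcover).trans (measure_iUnion_le _)
    _ = ∑' i, μ.map (Function.eval i) (K i)ᶜ := tsum_congr fun i =>
        (Measure.map_apply (measurable_pi_apply i) (hK i).measurableSet.compl).symm
    _ ≤ ∑' i, δ i := ENNReal.tsum_le_tsum fun i => hKδ i _ (mem_image_of_mem _ hμ)
    _ ≤ ε := hδε.le

/-- The probability measures on a product with prescribed one-dimensional marginals. -/
def couplings (μ : ∀ i, Measure (Z i)) : Set (ProbabilityMeasure (∀ i, Z i)) :=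
  {P | ∀ i, MeasurePreserving (Function.eval i) (P : Measure (∀ i, Z i)) (μ i)}

theorem isCompact_couplings [∀ i, PolishSpace (Z i)] [∀ i, BorelSpace (Z i)]
    (μ : ∀ i, Measure (Z i)) [∀ i, IsProbabilityMeasure (μ i)] : IsCompact (couplings μ) := by
  let (i : ι) := TopologicalSpace.upgradeIsCompletelyMetrizable (Z i)
  have hclosed : IsClosed (couplings μ) := by
    simp only [couplings, ofPred_forall]
    exact isClosed_iInter fun i => isClosed_setOf_measurePreserving (continuous_apply i) (μ i)
  have htight : IsTightMeasureSet
      {((P : ProbabilityMeasure (∀ i, Z i)) : Measure (∀ i, Z i)) | P ∈ couplings μ} := by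
    refine isTightMeasureSet_pi fun i => (isTightMeasureSet_singleton (μ := μ i)).subset ?_
    rintro _ ⟨_, ⟨P, hP, rfl⟩, rfl⟩
    exact (hP i).map_eq
  exact hclosed.closure_eq ▸ isCompact_closure_of_isTightMeasureSet htight

end Compactness

section Continuity

variable {E : Type*} [TopologicalSpace E] [MeasurableSpace E] [OpensMeasurableSpace E]
  {p : ℝ≥0∞}

theorem memLp_boundedContinuous (b : E →ᵇ ℝ) (μ : Measure E) [IsFiniteMeasure μ] : MemLp b p μ :=
  MemLp.of_bound b.continuous.aestronglyMeasurable ‖b‖ (ae_of_all _ b.norm_coe_le_norm)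

theorem continuous_eLpNorm_boundedContinuous (b : E →ᵇ ℝ) (hp₀ : p ≠ 0) (hp : p ≠ ∞) :
    Continuous fun P : ProbabilityMeasure E => eLpNorm b p (P : Measure E) := by
  let bp : E →ᵇ ℝ := .ofNormedAddCommGroup (fun x => ‖b x‖ ^ p.toReal)
    (b.continuous.norm.rpow_const fun _ => Or.inr ENNReal.toReal_nonneg) (‖b‖ ^ p.toReal)
    fun x => by
      rw [Real.norm_of_nonneg (by positivity)]
      gcongr
      exact b.norm_coe_le_norm x
  have hnorm (P : ProbabilityMeasure E) : eLpNorm b p (P : Measure E) =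
      ENNReal.ofReal ((∫ x, bp x ∂(P : Measure E)) ^ p.toReal⁻¹) :=
    (memLp_boundedContinuous b _).eLpNorm_eq_integral_rpow_norm hp₀ hp
  simp_rw [hnorm]
  exact ENNReal.continuous_ofReal.comp
    ((ProbabilityMeasure.continuous_integral_boundedContinuousFunction bp).rpow_const
      fun _ => Or.inr (inv_nonneg.2 ENNReal.toReal_nonneg))

/-- The functions that bounded continuous functions approximate in `Lᵖ(P)`, uniformly in `P ∈ S`.
On them, the `Lᵖ(P)` norm depends continuously on `P ∈ S`, although they may be discontinuous. -/
def uniformlyApproximable (p : ℝ≥0∞) [Fact (1 ≤ p)] (S : Set (ProbabilityMeasure E)) :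
    Submodule ℝ (E → ℝ) where
  carrier := {f | (∀ P ∈ S, AEStronglyMeasurable f (P : Measure E)) ∧
    ∀ ε ≠ 0, ∃ b : E →ᵇ ℝ, ∀ P ∈ S, eLpNorm (f - ⇑b) p (P : Measure E) ≤ ε}
  zero_mem' := ⟨fun _ _ => aestronglyMeasurable_zero, fun _ _ => ⟨0, fun _ _ => by simp⟩⟩
  add_mem' {f g} hf hg := by
    refine ⟨fun P hP => (hf.1 P hP).add (hg.1 P hP), fun ε hε => ?_⟩
    obtain ⟨b, hb⟩ := hf.2 (ε / 2) (ENNReal.half_pos hε).ne'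
    obtain ⟨c, hc⟩ := hg.2 (ε / 2) (ENNReal.half_pos hε).ne'
    refine ⟨b + c, fun P hP => ?_⟩
    calc eLpNorm (f + g - ⇑(b + c)) p (P : Measure E)
        = eLpNorm ((f - ⇑b) + (g - ⇑c)) p (P : Measure E) := by
          rw [BoundedContinuousFunction.coe_add, add_sub_add_comm]
      _ ≤ eLpNorm (f - ⇑b) p (P : Measure E) + eLpNorm (g - ⇑c) p (P : Measure E) :=
          eLpNorm_add_le ((hf.1 P hP).sub b.continuous.aestronglyMeasurable)
            ((hg.1 P hP).sub c.continuous.aestronglyMeasurable) Fact.out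
      _ ≤ ε := (add_le_add (hb P hP) (hc P hP)).trans_eq (ENNReal.add_halves ε)
  smul_mem' c f hf := by
    refine ⟨fun P hP => (hf.1 P hP).const_smul c, fun ε hε => ?_⟩
    obtain ⟨b, hb⟩ := hf.2 (ε / ‖c‖ₑ) (ENNReal.div_pos hε enorm_ne_top).ne'
    refine ⟨c • b, fun P hP => ?_⟩
    calc eLpNorm (c • f - ⇑(c • b)) p (P : Measure E)
        = ‖c‖ₑ * eLpNorm (f - ⇑b) p (P : Measure E) := by
          rw [BoundedContinuousFunction.coe_smul, ← eLpNorm_const_smul, smul_sub]; rfl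
      _ ≤ ‖c‖ₑ * (ε / ‖c‖ₑ) := by gcongr; exact hb P hP
      _ ≤ ε := ENNReal.mul_div_le

variable [Fact (1 ≤ p)] {S : Set (ProbabilityMeasure E)} {f : E → ℝ}

theorem memLp_of_mem_uniformlyApproximable (hf : f ∈ uniformlyApproximable p S)
    {P : ProbabilityMeasure E} (hP : P ∈ S) : MemLp f p (P : Measure E) := by
  obtain ⟨b, hb⟩ := hf.2 1 one_ne_zero
  have hfb : MemLp (f - ⇑b) p (P : Measure E) :=
    ⟨(hf.1 P hP).sub b.continuous.aestronglyMeasurable, (hb P hP).trans_lt ENNReal.one_lt_top⟩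
  simpa using hfb.add (memLp_boundedContinuous b _)

theorem continuousOn_eLpNorm (hp : p ≠ ∞) (hf : f ∈ uniformlyApproximable p S) :
    ContinuousOn (fun P : ProbabilityMeasure E => eLpNorm f p (P : Measure E)) S := by
  have hp₀ : p ≠ 0 := (zero_lt_one.trans_le Fact.out).ne'
  have hmem {P : ProbabilityMeasure E} (hP : P ∈ S) := memLp_of_mem_uniformlyApproximable hf hP
  have hreal : ContinuousOn (fun P : ProbabilityMeasure E => (eLpNorm f p (P : Measure E)).toReal)
      S := by
    refine continuousOn_of_uniform_approx_of_continuousOn fun u hu => ?_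
    obtain ⟨ε, hε, hu⟩ := Metric.mem_uniformity_dist.1 hu
    obtain ⟨b, hb⟩ := hf.2 (ENNReal.ofReal (ε / 2)) (by simpa using hε)
    have hbmem (P : ProbabilityMeasure E) : MemLp b p (P : Measure E) :=
      memLp_boundedContinuous b _
    refine ⟨fun P => (eLpNorm b p (P : Measure E)).toReal, ?_, fun P hP => hu ?_⟩
    · exact (continuous_iff_continuousAt.2 fun P => (ENNReal.tendsto_toReal (hbmem P).2.ne).comp
        (continuous_eLpNorm_boundedContinuous b hp₀ hp).continuousAt).continuousOn
    · calc dist (eLpNorm f p (P : Measure E)).toReal (eLpNorm b p (P : Measure E)).toReal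
          = |‖(hmem hP).toLp‖ - ‖(hbmem P).toLp‖| := by
            rw [Real.dist_eq, Lp.norm_toLp, Lp.norm_toLp]
        _ ≤ ‖(hmem hP).toLp - (hbmem P).toLp‖ := abs_norm_sub_norm_le _ _
        _ ≤ ε / 2 := by
            rw [← MemLp.toLp_sub, Lp.norm_toLp]
            exact ENNReal.toReal_le_of_le_ofReal (half_pos hε).le (hb P hP)
        _ < ε := half_lt_self hε
  exact (ENNReal.continuous_ofReal.comp_continuousOn hreal).congr fun P hP =>
    (ENNReal.ofReal_toReal (hmem hP).2.ne).symm

variable {Z : Type*} [TopologicalSpace Z] [PolishSpace Z] [MeasurableSpace Z] [BorelSpace Z]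
  {ζ : Measure Z} {φ : E → Z}

theorem comp_mem_uniformlyApproximable [IsFiniteMeasure ζ] (hp : p ≠ ∞) (hφ : Continuous φ)
    (hS : ∀ P ∈ S, MeasurePreserving φ (P : Measure E) ζ) {k : Z → ℝ} (hk : MemLp k p ζ) :
    k ∘ φ ∈ uniformlyApproximable p S := by
  refine ⟨fun P hP => hk.1.comp_measurePreserving (hS P hP), fun ε hε => ?_⟩
  let := TopologicalSpace.upgradeIsCompletelyMetrizable Z
  obtain ⟨b, hb, -⟩ := hk.exists_boundedContinuous_eLpNorm_sub_le hp hε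
  refine ⟨b.compContinuous ⟨φ, hφ⟩, fun P hP => le_of_eq_of_le ?_ hb⟩
  exact eLpNorm_comp_measurePreserving (hk.1.sub b.continuous.aestronglyMeasurable) (hS P hP)

variable [PolishSpace E]

theorem continuous_prod_self : Continuous fun P : ProbabilityMeasure E => P.prod P :=
  ProbabilityMeasure.continuous_prod.comp (continuous_id.prodMk continuous_id)

theorem pull_mem_uniformlyApproximable [IsFiniteMeasure ζ] (hp : p ≠ ∞) (hφ : Continuous φ)
    (hS : ∀ P ∈ S, MeasurePreserving φ (P : Measure E) ζ) {k : Z × Z → ℝ}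
    (hk : MemLp k p (ζ.prod ζ)) :
    pull φ k ∈ uniformlyApproximable p ((fun P => P.prod P) '' S) := by
  refine comp_mem_uniformlyApproximable hp (φ := fun q : E × E => (φ q.1, φ q.2)) (by fun_prop)
    ?_ hk
  rintro _ ⟨P, hP, rfl⟩
  exact measurePreserving_pair (hS P hP)

theorem continuousOn_eLpNorm_prod_self (hp : p ≠ ∞) {k : E × E → ℝ}
    (hk : k ∈ uniformlyApproximable p ((fun P => P.prod P) '' S)) :
    ContinuousOn (fun P : ProbabilityMeasure E =>
      eLpNorm k p ((P : Measure E).prod (P : Measure E))) S := by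
  have h := (continuousOn_eLpNorm hp hk).comp continuous_prod_self.continuousOn (mapsTo_image _ S)
  exact h

end Continuity

section PlansOfMaps

variable {X Y : GMSpace.{u}} {W : Type*} [MeasurableSpace W] {ω : Measure W}
  [IsProbabilityMeasure ω] {a : W → X} {b : W → Y} {τ : Measure (X × Y)}

theorem IsPlan.of_measurePreserving (ha : MeasurePreserving a ω X.measure)
    (hb : MeasurePreserving b ω Y.measure) : IsPlan X Y (ω.map fun w => (a w, b w)) where
  prob := Measure.isProbabilityMeasure_map (ha.measurable.prodMk hb.measurable).aemeasurable
  fst := (Measure.map_map measurable_fst (ha.measurable.prodMk hb.measurable)).trans ha.map_eq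
  snd := (Measure.map_map measurable_snd (ha.measurable.prodMk hb.measurable)).trans hb.map_eq

theorem IsPlan.discrepancy_eq_eLpNorm (hτ : IsPlan X Y τ)
    (hab : MeasurePreserving (fun w => (a w, b w)) ω τ) {f : X × X → ℝ} {f' : Y × Y → ℝ}
    (hf : IsGauge f X.measure) (hf' : IsGauge f' Y.measure) :
    discrepancy f f' τ = eLpNorm (pull a f - pull b f') 2 (ω.prod ω) := by
  have := hτ.prob
  exact (eLpNorm_comp_measurePreserving (aesm_discrepancy hτ hf hf')
    (measurePreserving_pair hab)).symm

theorem discrepancy_map_eq_zero (ha : MeasurePreserving a ω X.measure)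
    (hb : MeasurePreserving b ω Y.measure) {f : X × X → ℝ} {f' : Y × Y → ℝ}
    (hf : IsGauge f X.measure) (hf' : IsGauge f' Y.measure)
    (h : pull a f =ᵐ[ω.prod ω] pull b f') :
    discrepancy f f' (ω.map fun w => (a w, b w)) = 0 := by
  rw [discrepancy_map ha.measurable hb.measurable (.of_measurePreserving ha hb) hf hf']
  exact (eLpNorm_congr_ae (Filter.eventuallyEq_iff_sub.1 h)).trans eLpNorm_zero

theorem isOptimal_map (ha : MeasurePreserving a ω X.measure)
    (hb : MeasurePreserving b ω Y.measure) (h : pull a X.gauge =ᵐ[ω.prod ω] pull b Y.gauge) :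
    IsOptimal X Y (ω.map fun w => (a w, b w)) := by
  have hτ := IsPlan.of_measurePreserving ha hb
  have h₀ := discrepancy_map_eq_zero ha hb X.isGauge Y.isGauge h
  exact ⟨hτ, h₀.trans (nonpos_iff_eq_zero.1 ((gwDist_le hτ).trans_eq h₀)).symm⟩

theorem toClass_eq_of_pull_ae_eq (ha : MeasurePreserving a ω X.measure)
    (hb : MeasurePreserving b ω Y.measure)
    (h : pull a X.gauge =ᵐ[ω.prod ω] pull b Y.gauge) : X.toClass = Y.toClass :=
  toClass_eq_iff.2 <| (isOptimal_map ha hb h).eq_gwDist.symm.trans <|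
    discrepancy_map_eq_zero ha hb X.isGauge Y.isGauge h

theorem IsOptimal.pull_ae_eq (hτ : IsOptimal X Y τ) (hXY : X.toClass = Y.toClass)
    (hab : MeasurePreserving (fun w => (a w, b w)) ω τ) :
    pull a X.gauge =ᵐ[ω.prod ω] pull b Y.gauge := by
  have := hτ.isPlan.prob
  have h₀ : discrepancy X.gauge Y.gauge τ = 0 := hτ.eq_gwDist.trans (toClass_eq_iff.1 hXY)
  exact (measurePreserving_pair hab).quasiMeasurePreserving.ae
    ((discrepancy_eq_zero_iff hτ.isPlan X.isGauge Y.isGauge).1 h₀)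

theorem planEquiv_of_mem_meltings {σ : Measure (X × X)} {π π' : Measure (X × Y)}
    (hσ : IsOptimal X X σ) (hπ : IsOptimal X Y π) (h : π' ∈ meltings X X Y σ π) :
    PlanEquiv X Y π' π := by
  refine ⟨?_, hπ, σ, hσ, h⟩
  obtain ⟨γ, hγ, hπ'⟩ := h
  replace hπ' : π' = γ.map fun p => (p.2.1, p.2.2) := hπ'
  have := hγ.prob
  have hγσ : MeasurePreserving (fun p : X × X × Y => (p.1, p.2.1)) γ σ := ⟨by fun_prop, hγ.left⟩
  have hγπ : MeasurePreserving (fun p : X × X × Y => (p.1, p.2.2)) γ π := ⟨by fun_prop, hγ.right⟩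
  have hsnd : MeasurePreserving (fun p : X × X × Y => p.2.1) γ X.measure :=
    hσ.isPlan.mp_snd.comp hγσ
  have hthd : MeasurePreserving (fun p : X × X × Y => p.2.2) γ Y.measure :=
    hπ.isPlan.mp_snd.comp (f := fun p : X × X × Y => (p.1, p.2.2)) hγπ
  have hplan : IsPlan X Y π' := hπ' ▸ IsPlan.of_measurePreserving hsnd hthd
  have hgauge : pull (fun p : X × X × Y => p.1) X.gauge =ᵐ[γ.prod γ]
      pull (fun p : X × X × Y => p.2.1) X.gauge := hσ.pull_ae_eq rfl hγσ
  refine ⟨hplan, ?_⟩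
  calc discrepancy X.gauge Y.gauge π'
      = eLpNorm (pull (fun p : X × X × Y => p.2.1) X.gauge -
          pull (fun p : X × X × Y => p.2.2) Y.gauge) 2 (γ.prod γ) :=
        hplan.discrepancy_eq_eLpNorm ⟨by fun_prop, hπ'.symm⟩ X.isGauge Y.isGauge
    _ = eLpNorm (pull (fun p : X × X × Y => p.1) X.gauge -
          pull (fun p : X × X × Y => p.2.2) Y.gauge) 2 (γ.prod γ) :=
        eLpNorm_congr_ae (hgauge.symm.sub (ae_eq_refl _))
    _ = discrepancy X.gauge Y.gauge π :=
        (hπ.isPlan.discrepancy_eq_eLpNorm hγπ X.isGauge Y.isGauge).symm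
    _ = gwDist X Y := hπ.eq_gwDist

variable {𝔜 : GMClass.{u}} {f f' : TangentRep 𝔜} {a : W → f.base} {b : W → f'.base}

theorem TangentRep.dist_le_eLpNorm (ha : MeasurePreserving a ω f.base.measure)
    (hb : MeasurePreserving b ω f'.base.measure)
    (hab : pull a f.base.gauge =ᵐ[ω.prod ω] pull b f'.base.gauge) :
    f.dist f' ≤ eLpNorm (pull a f.toFun - pull b f'.toFun) 2 (ω.prod ω) := by
  have hτ := isOptimal_map ha hb hab
  exact (dist_le hτ).trans_eq
    (discrepancy_map ha.measurable hb.measurable hτ.isPlan f.isGauge f'.isGauge)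

theorem TangentRep.toTangent_eq_of_pull_ae_eq (ha : MeasurePreserving a ω f.base.measure)
    (hb : MeasurePreserving b ω f'.base.measure)
    (hab : pull a f.base.gauge =ᵐ[ω.prod ω] pull b f'.base.gauge)
    (hff' : pull a f.toFun =ᵐ[ω.prod ω] pull b f'.toFun) : f.toTangent = f'.toTangent :=
  Quotient.sound <| TangentRep.equivalent_iff.2 ⟨_, isOptimal_map ha hb hab,
    discrepancy_map_eq_zero ha hb f.isGauge f'.isGauge hff'⟩

end PlansOfMaps

section OptimalPlans

variable {X Y : GMSpace.{u}}

theorem isCompact_setOf_isPlan :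
    IsCompact {P : ProbabilityMeasure (X × Y) | IsPlan X Y (P : Measure (X × Y))} := by
  let := TopologicalSpace.upgradeIsCompletelyMetrizable X
  let := TopologicalSpace.upgradeIsCompletelyMetrizable Y
  have hset : {P : ProbabilityMeasure (X × Y) | IsPlan X Y (P : Measure (X × Y))} =
      {P : ProbabilityMeasure (X × Y) |
        MeasurePreserving Prod.fst (P : Measure (X × Y)) X.measure} ∩
        {P : ProbabilityMeasure (X × Y) |
          MeasurePreserving Prod.snd (P : Measure (X × Y)) Y.measure} := by
    ext P
    exact ⟨fun h => ⟨h.mp_fst, h.mp_snd⟩, fun h => ⟨inferInstance, h.1.map_eq, h.2.map_eq⟩⟩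
  have hclosed : IsClosed {P : ProbabilityMeasure (X × Y) | IsPlan X Y (P : Measure (X × Y))} :=
    hset ▸ (isClosed_setOf_measurePreserving continuous_fst _).inter
      (isClosed_setOf_measurePreserving continuous_snd _)
  have htight : IsTightMeasureSet {((P : ProbabilityMeasure (X × Y)) : Measure (X × Y)) |
      P ∈ {P : ProbabilityMeasure (X × Y) | IsPlan X Y (P : Measure (X × Y))}} := by
    refine .prodMk ((isTightMeasureSet_singleton (μ := X.measure)).subset ?_)
      ((isTightMeasureSet_singleton (μ := Y.measure)).subset ?_)
    · rintro _ ⟨_, ⟨P, hP, rfl⟩, rfl⟩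
      exact hP.fst
    · rintro _ ⟨_, ⟨P, hP, rfl⟩, rfl⟩
      exact hP.snd
  exact hclosed.closure_eq ▸ isCompact_closure_of_isTightMeasureSet htight

theorem continuousOn_discrepancy {f : X × X → ℝ} {f' : Y × Y → ℝ} (hf : IsGauge f X.measure)
    (hf' : IsGauge f' Y.measure) :
    ContinuousOn (fun P : ProbabilityMeasure (X × Y) => discrepancy f f' (P : Measure (X × Y)))
      {P | IsPlan X Y (P : Measure (X × Y))} :=
  continuousOn_eLpNorm_prod_self ENNReal.ofNat_ne_top <| Submodule.sub_mem _
    (pull_mem_uniformlyApproximable ENNReal.ofNat_ne_top continuous_fst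
      (fun _ => IsPlan.mp_fst) hf.memLp)
    (pull_mem_uniformlyApproximable ENNReal.ofNat_ne_top continuous_snd
      (fun _ => IsPlan.mp_snd) hf'.memLp)

theorem exists_isOptimal (X Y : GMSpace.{u}) : ∃ τ, IsOptimal X Y τ := by
  have hne : {P : ProbabilityMeasure (X × Y) | IsPlan X Y (P : Measure (X × Y))}.Nonempty :=
    ⟨⟨X.measure.prod Y.measure, inferInstance⟩,
      ⟨Measure.prod.instIsProbabilityMeasure _ _, Measure.fst_prod, Measure.snd_prod⟩⟩
  obtain ⟨P, hP, hmin⟩ := isCompact_setOf_isPlan.exists_isMinOn hne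
    (continuousOn_discrepancy X.isGauge Y.isGauge)
  refine ⟨P, hP, le_antisymm (le_iInf fun τ => ?_) (gwDist_le hP)⟩
  exact hmin (a := (⟨τ.1, τ.2.prob⟩ : ProbabilityMeasure (X × Y))) τ.2

theorem isCompact_setOf_isOptimal :
    IsCompact {P : ProbabilityMeasure (X × Y) | IsOptimal X Y (P : Measure (X × Y))} := by
  have hset : {P : ProbabilityMeasure (X × Y) | IsOptimal X Y (P : Measure (X × Y))} =
      {P : ProbabilityMeasure (X × Y) | IsPlan X Y (P : Measure (X × Y))} ∩
        (fun P : ProbabilityMeasure (X × Y) => gwFunctional X Y (P : Measure (X × Y))) ⁻¹'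
          {gwDist X Y} := by
    ext P
    exact ⟨fun h => ⟨h.isPlan, h.eq_gwDist⟩, fun h => ⟨h.1, h.2⟩⟩
  refine isCompact_setOf_isPlan.of_isClosed_subset ?_ fun P hP => hP.isPlan
  rw [hset]
  exact (continuousOn_discrepancy X.isGauge Y.isGauge).preimage_isClosed_of_isClosed
    isCompact_setOf_isPlan.isClosed isClosed_singleton

theorem TangentRep.exists_discrepancy_eq_dist {𝔜 : GMClass.{u}} (f f' : TangentRep 𝔜) :
    ∃ τ, IsOptimal f.base f'.base τ ∧ discrepancy f.toFun f'.toFun τ = f.dist f' := by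
  obtain ⟨τ₀, hτ₀⟩ := exists_isOptimal f.base f'.base
  have hne : {P : ProbabilityMeasure (f.base × f'.base) |
      IsOptimal f.base f'.base (P : Measure (f.base × f'.base))}.Nonempty :=
    ⟨⟨τ₀, hτ₀.isPlan.prob⟩, hτ₀⟩
  obtain ⟨P, hP, hmin⟩ := isCompact_setOf_isOptimal.exists_isMinOn hne
    ((continuousOn_discrepancy f.isGauge f'.isGauge).mono fun P hP => hP.isPlan)
  refine ⟨P, hP, le_antisymm (le_iInf fun τ => ?_) (dist_le hP)⟩
  exact hmin (a := (⟨τ.1, τ.2.isPlan.prob⟩ : ProbabilityMeasure _)) τ.2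

end OptimalPlans

section WeightedMean

variable {ι α : Type*} [Fintype ι] {ρ : ι → ℝ}

theorem sum_mul_sub_mean_sq_le (hρ : ρ ∈ stdSimplex ℝ ι) (a : ι → ℝ) (c : ℝ) :
    ∑ i, ρ i * (a i - ∑ j, ρ j * a j) ^ 2 ≤ ∑ i, ρ i * (a i - c) ^ 2 := by
  set m := ∑ j, ρ j * a j with hm
  have hsteiner : ∑ i, ρ i * (a i - c) ^ 2 = ∑ i, ρ i * (a i - m) ^ 2 + (m - c) ^ 2 := by
    have hterm (i : ι) : ρ i * (a i - c) ^ 2 =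
        ρ i * (a i - m) ^ 2 + (2 * (m - c) * (ρ i * a i) + (c ^ 2 - m ^ 2) * ρ i) := by ring
    simp_rw [hterm, Finset.sum_add_distrib, ← Finset.mul_sum]
    rw [hρ.2, ← hm]
    ring
  exact hsteiner ▸ le_add_of_nonneg_right (sq_nonneg _)

theorem nonempty_of_mem_stdSimplex (hρ : ρ ∈ stdSimplex ℝ ι) : Nonempty ι := by
  by_contra! h
  exact (stdSimplex_of_isEmpty_index ℝ ι).subset hρ

variable [MeasurableSpace α] {μ : Measure α}

theorem sum_mul_eLpNorm_sq (hρ : ∀ i, 0 ≤ ρ i) {F : ι → α → ℝ}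
    (hF : ∀ i, AEStronglyMeasurable (F i) μ) :
    ∑ i, ENNReal.ofReal (ρ i) * eLpNorm (F i) 2 μ ^ 2 =
      ∫⁻ x, ENNReal.ofReal (∑ i, ρ i * F i x ^ 2) ∂μ := by
  have hsq (i : ι) : eLpNorm (F i) 2 μ ^ 2 = ∫⁻ x, ENNReal.ofReal (F i x ^ 2) ∂μ := by
    have h := eLpNorm_nnreal_pow_eq_lintegral (f := F i) (μ := μ) (p := 2) two_ne_zero
    simp only [NNReal.coe_ofNat, ENNReal.coe_ofNat, ENNReal.rpow_ofNat] at h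
    refine h.trans (lintegral_congr fun x => ?_)
    rw [Real.enorm_eq_ofReal_abs, ← ENNReal.ofReal_pow (abs_nonneg _), sq_abs]
  have hmeas (i : ι) : AEMeasurable (fun x => ENNReal.ofReal (F i x ^ 2)) μ :=
    ((hF i).aemeasurable.pow_const 2).ennreal_ofReal
  calc ∑ i, ENNReal.ofReal (ρ i) * eLpNorm (F i) 2 μ ^ 2
      = ∫⁻ x, ∑ i, ENNReal.ofReal (ρ i) * ENNReal.ofReal (F i x ^ 2) ∂μ := by
        rw [lintegral_finsetSum' _ fun i _ => (hmeas i).const_mul _]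
        simp_rw [hsq, lintegral_const_mul'' _ (hmeas _)]
    _ = ∫⁻ x, ENNReal.ofReal (∑ i, ρ i * F i x ^ 2) ∂μ := by
        refine lintegral_congr fun x => ?_
        rw [ENNReal.ofReal_sum_of_nonneg fun i _ => mul_nonneg (hρ i) (sq_nonneg _)]
        simp_rw [ENNReal.ofReal_mul (hρ _)]

theorem sum_mul_eLpNorm_sub_mean_sq_le (hρ : ρ ∈ stdSimplex ℝ ι) {F : ι → α → ℝ} {c : α → ℝ}
    (hF : ∀ i, AEStronglyMeasurable (F i) μ) (hc : AEStronglyMeasurable c μ) :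
    ∑ i, ENNReal.ofReal (ρ i) * eLpNorm (F i - fun x => ∑ j, ρ j * F j x) 2 μ ^ 2 ≤
      ∑ i, ENNReal.ofReal (ρ i) * eLpNorm (F i - c) 2 μ ^ 2 := by
  have hmean : AEStronglyMeasurable (fun x => ∑ j, ρ j * F j x) μ :=
    Finset.aestronglyMeasurable_fun_sum _ fun j _ => (hF j).const_mul (ρ j)
  rw [sum_mul_eLpNorm_sq hρ.1 fun i => (hF i).sub hmean,
    sum_mul_eLpNorm_sq hρ.1 fun i => (hF i).sub hc]
  exact lintegral_mono fun x =>
    ENNReal.ofReal_le_ofReal (sum_mul_sub_mean_sq_le hρ (fun i => F i x) (c x))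

end WeightedMean

section PairwiseOptimal

variable {ι : Type*} {Z : ι → GMSpace.{u}}

/-- The probability measures on `∏ᵢ Zᵢ` all of whose two-dimensional marginals are optimal plans.
If the `Zᵢ` are homomorphic, the gauges of all `Zᵢ` agree almost everywhere along such a measure. -/
def pairwiseOptimal (Z : ι → GMSpace.{u}) : Set (ProbabilityMeasure (∀ i, Z i)) :=
  {P | ∀ i j, IsOptimal (Z i) (Z j) ((P : Measure (∀ i, Z i)).map fun z => (z i, z j))}

theorem pairwiseOptimal_subset_couplings :
    pairwiseOptimal Z ⊆ couplings fun i => (Z i).measure := by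
  intro P hP i
  have hdiag : Measurable fun z : ∀ i, Z i => (z i, z i) := by fun_prop
  exact (hP i i).isPlan.mp_fst.comp (hdiag.measurePreserving _)

theorem isCompact_pairwiseOptimal [Countable ι] : IsCompact (pairwiseOptimal Z) := by
  refine (isCompact_couplings _).of_isClosed_subset ?_ pairwiseOptimal_subset_couplings
  simp only [pairwiseOptimal, ofPred_forall]
  refine isClosed_iInter fun i => isClosed_iInter fun j => ?_
  have hpair : Continuous fun z : ∀ i, Z i => (z i, z j) := by fun_prop
  exact isCompact_setOf_isOptimal.isClosed.preimage (ProbabilityMeasure.continuous_map hpair)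

theorem pull_gauge_ae_eq_of_mem_pairwiseOptimal {P : ProbabilityMeasure (∀ i, Z i)}
    (hP : P ∈ pairwiseOptimal Z) {i j : ι} (hij : (Z i).toClass = (Z j).toClass) :
    pull (Function.eval i) (Z i).gauge =ᵐ[(P : Measure (∀ i, Z i)).prod P]
      pull (Function.eval j) (Z j).gauge :=
  (hP i j).pull_ae_eq hij (Measurable.measurePreserving (by fun_prop) _)

end PairwiseOptimal

section Barycenter

variable {N : ℕ} {𝔜 : GMClass.{u}} (ρ : Fin N → ℝ) (f : Fin N → TangentRep 𝔜)

/-- The weighted mean of the gauges `fᵢ`, as a gauge on the product of their bases. -/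
def jointMean : (∀ i, (f i).base) × (∀ i, (f i).base) → ℝ :=
  fun p => ∑ i, ρ i * (f i).toFun (p.1 i, p.2 i)

/-- The weighted variance of the gauges `fᵢ` along a coupling `P` of their bases. -/
noncomputable def dispersion (P : ProbabilityMeasure (∀ i, (f i).base)) : ℝ≥0∞ :=
  ∑ i, ENNReal.ofReal (ρ i) * eLpNorm (pull (Function.eval i) (f i).toFun - jointMean ρ f) 2
    ((P : Measure (∀ i, (f i).base)).prod P) ^ 2

variable {ρ f} {P : ProbabilityMeasure (∀ i, (f i).base)}

theorem isGauge_jointMean (hP : P ∈ couplings fun i => (f i).base.measure) :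
    IsGauge (jointMean ρ f) (P : Measure (∀ i, (f i).base)) :=
  IsGauge.weightedSum ρ fun i => (f i).isGauge.pull (hP i)

theorem dispersion_eq_of_measurePreserving (hP : P ∈ couplings fun i => (f i).base.measure)
    {W : Type*} [MeasurableSpace W] {ω : Measure W} [SFinite ω] {a : W → ∀ i, (f i).base}
    (ha : MeasurePreserving a ω (P : Measure (∀ i, (f i).base))) :
    dispersion ρ f P = ∑ i, ENNReal.ofReal (ρ i) * eLpNorm (pull (fun w => a w i) (f i).toFun -
      fun q => ∑ j, ρ j * pull (fun w => a w j) (f j).toFun q) 2 (ω.prod ω) ^ 2 := by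
  refine Finset.sum_congr rfl fun i _ => ?_
  rw [← eLpNorm_comp_measurePreserving (((f i).isGauge.pull (hP i)).sub
    (isGauge_jointMean hP)).memLp.1 (measurePreserving_pair ha)]
  rfl

theorem continuousOn_dispersion :
    ContinuousOn (dispersion ρ f) (couplings fun i => (f i).base.measure) := by
  have hcoord (i : Fin N) : pull (Function.eval i) (f i).toFun ∈ uniformlyApproximable 2
      ((fun P => P.prod P) '' couplings fun i => (f i).base.measure) :=
    pull_mem_uniformlyApproximable ENNReal.ofNat_ne_top (continuous_apply i)
      (fun P (hP : P ∈ couplings fun i => (f i).base.measure) => hP i) (f i).isGauge.memLp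
  have hmean : jointMean ρ f = ∑ i, ρ i • pull (Function.eval i) (f i).toFun := by
    ext p
    simp [jointMean, pull]
  refine continuousOn_finsetSum _ fun i _ => (ENNReal.continuous_const_mul
    ENNReal.ofReal_ne_top).comp_continuousOn ((ENNReal.continuous_pow 2).comp_continuousOn ?_)
  refine continuousOn_eLpNorm_prod_self ENNReal.ofNat_ne_top (Submodule.sub_mem _ (hcoord i) ?_)
  exact hmean ▸ Submodule.sum_mem _ fun j _ => Submodule.smul_mem _ _ (hcoord j)

theorem exists_dispersion_le_barycenterLoss (hρ : ρ ∈ stdSimplex ℝ (Fin N))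
    (f : Fin N → TangentRep 𝔜) (g : TangentRep 𝔜) :
    ∃ P ∈ pairwiseOptimal fun i => (f i).base,
      dispersion ρ f P ≤ barycenterLoss ρ (fun i => (f i).toTangent) g.toTangent := by
  choose τ hτ hdist using fun i => (f i).exists_discrepancy_eq_dist g
  have (i : Fin N) := (hτ i).isPlan.prob
  obtain ⟨ω, hωg, hωτ⟩ := exists_common_gluing fun i => (hτ i).isPlan.snd
  have : IsProbabilityMeasure (ω.map Prod.snd) := hωg.map_eq ▸ g.base.prob
  have : IsProbabilityMeasure ω := Measure.isProbabilityMeasure_of_map Prod.snd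
  let c (i : Fin N) (p : (∀ i, (f i).base) × g.base) : (f i).base := p.1 i
  have hc (i : Fin N) : MeasurePreserving (c i) ω (f i).base.measure :=
    (hτ i).isPlan.mp_fst.comp (hωτ i)
  have hgauge (i : Fin N) : pull (c i) (f i).base.gauge =ᵐ[ω.prod ω] pull Prod.snd g.base.gauge :=
    (hτ i).pull_ae_eq ((f i).base_mem.trans g.base_mem.symm) (hωτ i)
  let P : ProbabilityMeasure (∀ i, (f i).base) :=
    ⟨ω.map Prod.fst, Measure.isProbabilityMeasure_map measurable_fst.aemeasurable⟩
  have hP : MeasurePreserving Prod.fst ω (P : Measure (∀ i, (f i).base)) := ⟨measurable_fst, rfl⟩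
  have hPopt : P ∈ pairwiseOptimal fun i => (f i).base := by
    intro i j
    rw [← hP.map_eq, Measure.map_map (by fun_prop) measurable_fst]
    exact isOptimal_map (hc i) (hc j) ((hgauge i).trans (hgauge j).symm)
  refine ⟨P, hPopt, ?_⟩
  calc dispersion ρ f P
      = ∑ i, ENNReal.ofReal (ρ i) * eLpNorm (pull (c i) (f i).toFun -
          fun q => ∑ j, ρ j * pull (c j) (f j).toFun q) 2 (ω.prod ω) ^ 2 :=
        dispersion_eq_of_measurePreserving (pairwiseOptimal_subset_couplings hPopt) hP
    _ ≤ ∑ i, ENNReal.ofReal (ρ i) *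
          eLpNorm (pull (c i) (f i).toFun - pull Prod.snd g.toFun) 2 (ω.prod ω) ^ 2 :=
        sum_mul_eLpNorm_sub_mean_sq_le hρ (fun i => ((f i).isGauge.pull (hc i)).memLp.1)
          (g.isGauge.pull hωg).memLp.1
    _ = barycenterLoss ρ (fun i => (f i).toTangent) g.toTangent := by
        refine Finset.sum_congr rfl fun i _ => ?_
        rw [← (hτ i).isPlan.discrepancy_eq_eLpNorm (hωτ i) (f i).isGauge g.isGauge, hdist]
        rfl

theorem exists_isMinOn_dispersion (hρ : ρ ∈ stdSimplex ℝ (Fin N)) :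
    ∃ P ∈ pairwiseOptimal fun i => (f i).base,
      IsMinOn (dispersion ρ f) (pairwiseOptimal fun i => (f i).base) P := by
  obtain ⟨i₀⟩ := nonempty_of_mem_stdSimplex hρ
  obtain ⟨P, hP, -⟩ := exists_dispersion_le_barycenterLoss hρ f (f i₀)
  exact isCompact_pairwiseOptimal.exists_isMinOn ⟨P, hP⟩
    (continuousOn_dispersion.mono pairwiseOptimal_subset_couplings)

/-- The product of the bases of the `fᵢ` with a pairwise optimal coupling `P`. It carries the gauge
of the `i₀`-th base; up to null sets, this gauge does not depend on `i₀`. -/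
def meanBase (i₀ : Fin N) (hP : P ∈ pairwiseOptimal fun i => (f i).base) : GMSpace.{u} where
  carrier := ∀ i, (f i).base
  gauge := pull (Function.eval i₀) (f i₀).base.gauge
  measure := P
  isGauge := (f i₀).base.isGauge.pull (pairwiseOptimal_subset_couplings hP i₀)

theorem toClass_meanBase (i₀ : Fin N) (hP : P ∈ pairwiseOptimal fun i => (f i).base) :
    (meanBase i₀ hP).toClass = 𝔜 := by
  have h : (meanBase i₀ hP).toClass = (f i₀).base.toClass :=
    toClass_eq_of_pull_ae_eq (a := id) (b := Function.eval i₀) (MeasurePreserving.id _)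
      (pairwiseOptimal_subset_couplings hP i₀) (ae_eq_refl _)
  exact h.trans (f i₀).base_mem

/-- The weighted mean of the gauges `fᵢ` along a pairwise optimal coupling `P` of their bases. -/
def meanRep (ρ : Fin N → ℝ) (i₀ : Fin N) (hP : P ∈ pairwiseOptimal fun i => (f i).base) :
    TangentRep 𝔜 where
  base := meanBase i₀ hP
  base_mem := toClass_meanBase i₀ hP
  toFun := jointMean ρ f
  isGauge := isGauge_jointMean (pairwiseOptimal_subset_couplings hP)

theorem barycenterLoss_meanRep_le (i₀ : Fin N) (hP : P ∈ pairwiseOptimal fun i => (f i).base) :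
    barycenterLoss ρ (fun i => (f i).toTangent) (meanRep ρ i₀ hP).toTangent ≤
      dispersion ρ f P := by
  have hgauge (i : Fin N) : pull (Function.eval i) (f i).base.gauge
      =ᵐ[(P : Measure (∀ i, (f i).base)).prod P] pull (Function.eval i₀) (f i₀).base.gauge :=
    pull_gauge_ae_eq_of_mem_pairwiseOptimal (Z := fun i => (f i).base) hP
      ((f i).base_mem.trans (f i₀).base_mem.symm)
  have hdist (i : Fin N) : (f i).dist (meanRep ρ i₀ hP) ≤
      eLpNorm (pull (Function.eval i) (f i).toFun - jointMean ρ f) 2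
        ((P : Measure (∀ i, (f i).base)).prod P) :=
    TangentRep.dist_le_eLpNorm (f := f i) (f' := meanRep ρ i₀ hP) (a := Function.eval i) (b := id)
      (ω := (P : Measure (∀ i, (f i).base)))
      (pairwiseOptimal_subset_couplings hP i) (MeasurePreserving.id _) (hgauge i)
  exact Finset.sum_le_sum fun i _ => mul_le_mul_right (pow_le_pow_left' (hdist i) 2) _

theorem isTangentialBarycenter_meanRep (hρ : ρ ∈ stdSimplex ℝ (Fin N)) (i₀ : Fin N)
    (hP : P ∈ pairwiseOptimal fun i => (f i).base)
    (hmin : IsMinOn (dispersion ρ f) (pairwiseOptimal fun i => (f i).base) P) :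
    IsTangentialBarycenter ρ (fun i => (f i).toTangent) (meanRep ρ i₀ hP).toTangent := by
  refine le_antisymm (le_iInf fun 𝔣 => ?_) (iInf_le _ _)
  obtain ⟨g, rfl⟩ : ∃ g : TangentRep 𝔜, g.toTangent = 𝔣 := Quotient.exists_rep 𝔣
  obtain ⟨Q, hQ, hQg⟩ := exists_dispersion_le_barycenterLoss hρ f g
  exact (barycenterLoss_meanRep_le i₀ hP).trans ((hmin hQ).trans hQg)

end Barycenter

section Lifts

/-- The representative `(g - h)|_{(Y × X, h, π)}` of the lift of `𝕏` along a plan `π`. -/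
def liftRep (Y X : GMSpace.{u}) (π : Measure (Y × X)) (hπ : IsPlan Y X π) :
    TangentRep Y.toClass where
  base := Y.over π hπ.prob hπ.fst
  base_mem := Y.over_toClass π hπ.prob hπ.fst
  toFun := pull Prod.snd X.gauge - pull Prod.fst Y.gauge
  isGauge :=
    have := hπ.prob
    (X.isGauge.pull hπ.mp_snd).sub (Y.isGauge.pull hπ.mp_fst)

variable {N : ℕ} {Y : GMSpace.{u}} {X : Fin N → GMSpace.{u}} {π : ∀ i, Measure (Y × X i)}
  {hπ : ∀ i, IsPlan Y (X i) (π i)} {P : ProbabilityMeasure (∀ i, Y × X i)}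

theorem measurePreserving_base
    (hP : P ∈ pairwiseOptimal fun i => (liftRep Y (X i) (π i) (hπ i)).base) (i : Fin N) :
    MeasurePreserving (fun z : ∀ i, Y × X i => (z i).1) (P : Measure (∀ i, Y × X i)) Y.measure :=
  (hπ i).mp_fst.comp (f := fun z : ∀ i, Y × X i => z i) (pairwiseOptimal_subset_couplings hP i)

theorem measurePreserving_target
    (hP : P ∈ pairwiseOptimal fun i => (liftRep Y (X i) (π i) (hπ i)).base) (i : Fin N) :
    MeasurePreserving (fun z : ∀ i, Y × X i => (z i).2) (P : Measure (∀ i, Y × X i))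
      (X i).measure :=
  (hπ i).mp_snd.comp (f := fun z : ∀ i, Y × X i => z i) (pairwiseOptimal_subset_couplings hP i)

theorem pull_base_gauge_ae_eq
    (hP : P ∈ pairwiseOptimal fun i => (liftRep Y (X i) (π i) (hπ i)).base) (i j : Fin N) :
    pull (fun z : ∀ i, Y × X i => (z i).1) Y.gauge
      =ᵐ[(P : Measure (∀ i, Y × X i)).prod (P : Measure (∀ i, Y × X i))]
      pull (fun z : ∀ i, Y × X i => (z j).1) Y.gauge :=
  pull_gauge_ae_eq_of_mem_pairwiseOptimal
    (Z := fun i => (liftRep Y (X i) (π i) (hπ i)).base) hP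
    ((liftRep Y (X i) (π i) (hπ i)).base_mem.trans (liftRep Y (X j) (π j) (hπ j)).base_mem.symm)

/-- The map `((y₁, x₁), …, (y_N, x_N)) ↦ (y_{i₀}, x₁, …, x_N)`, which turns a coupling of plans into
a gluing. -/
def shareBase (Y : GMSpace.{u}) (X : Fin N → GMSpace.{u}) (i₀ : Fin N) (z : ∀ i, Y × X i) :
    Y × ∀ i, X i :=
  ((z i₀).1, fun i => (z i).2)

theorem measurable_shareBase (i₀ : Fin N) : Measurable (shareBase Y X i₀) := by
  unfold shareBase
  fun_prop

/-- The `i`-th plan `π_i^*` of the gluing obtained from a coupling `P` of plans by `shareBase`. -/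
noncomputable def sharedPlan (i₀ : Fin N) (P : ProbabilityMeasure (∀ i, Y × X i)) (i : Fin N) :
    Measure (Y × X i) :=
  (P : Measure (∀ i, Y × X i)).map fun z => ((z i₀).1, (z i).2)

theorem isPlan_sharedPlan
    (hP : P ∈ pairwiseOptimal fun i => (liftRep Y (X i) (π i) (hπ i)).base) (i₀ i : Fin N) :
    IsPlan Y (X i) (sharedPlan i₀ P i) :=
  .of_measurePreserving (measurePreserving_base hP i₀) (measurePreserving_target hP i)

theorem isGluing_map_shareBase
    (hP : P ∈ pairwiseOptimal fun i => (liftRep Y (X i) (π i) (hπ i)).base) (i₀ : Fin N) :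
    IsGluing Y X (sharedPlan i₀ P) ((P : Measure (∀ i, Y × X i)).map (shareBase Y X i₀)) where
  prob := Measure.isProbabilityMeasure_map (measurable_shareBase i₀).aemeasurable
  fst := (Measure.map_map measurable_fst (measurable_shareBase i₀)).trans
    (measurePreserving_base hP i₀).map_eq
  marginal _ := Measure.map_map (by fun_prop) (measurable_shareBase i₀)

theorem exists_isOptimal_sharedPlan_mem_meltings
    (hP : P ∈ pairwiseOptimal fun i => (liftRep Y (X i) (π i) (hπ i)).base) (i₀ i : Fin N) :
    ∃ σ, IsOptimal Y Y σ ∧ sharedPlan i₀ P i ∈ meltings Y Y (X i) σ (π i) := by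
  have hm : Measurable fun z : ∀ i, Y × X i => ((z i).1, (z i₀).1, (z i).2) := by fun_prop
  let γ := (P : Measure (∀ i, Y × X i)).map fun z => ((z i).1, (z i₀).1, (z i).2)
  have hσ : IsOptimal Y Y ((P : Measure (∀ i, Y × X i)).map fun z => ((z i).1, (z i₀).1)) :=
    isOptimal_map (a := fun z : ∀ i, Y × X i => (z i).1) (b := fun z : ∀ i, Y × X i => (z i₀).1)
      (measurePreserving_base hP i) (measurePreserving_base hP i₀) (pull_base_gauge_ae_eq hP i i₀)
  have hγ : IsGluing₂ Y Y (X i) _ (π i) γ :=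
    ⟨Measure.isProbabilityMeasure_map hm.aemeasurable, Measure.map_map (by fun_prop) hm,
      (Measure.map_map (by fun_prop) hm).trans (pairwiseOptimal_subset_couplings hP i).map_eq⟩
  exact ⟨_, hσ, γ, hγ, (Measure.map_map measurable_snd hm).symm⟩

theorem toTangent_meanRep_liftRep {ρ : Fin N → ℝ} (hρ : ∑ i, ρ i = 1) (i₀ : Fin N)
    (hP : P ∈ pairwiseOptimal fun i => (liftRep Y (X i) (π i) (hπ i)).base) :
    (meanRep ρ i₀ hP).toTangent = meanTangent Y X ρ (sharedPlan i₀ P) (isPlan_sharedPlan hP i₀)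
      ((P : Measure (∀ i, Y × X i)).map (shareBase Y X i₀)) (isGluing_map_shareBase hP i₀) := by
  have hmean : jointMean ρ (fun i => liftRep Y (X i) (π i) (hπ i))
      =ᵐ[(P : Measure (∀ i, Y × X i)).prod (P : Measure (∀ i, Y × X i))]
      pull (shareBase Y X i₀) (pull Prod.snd (meanGauge X ρ) - pull Prod.fst Y.gauge) := by
    filter_upwards [ae_all_iff.2 fun i => pull_base_gauge_ae_eq hP i i₀] with p hp
    calc ∑ i, ρ i * ((X i).gauge ((p.1 i).2, (p.2 i).2) - Y.gauge ((p.1 i).1, (p.2 i).1))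
        = ∑ i, ρ i * ((X i).gauge ((p.1 i).2, (p.2 i).2) - Y.gauge ((p.1 i₀).1, (p.2 i₀).1)) :=
          Finset.sum_congr rfl fun i _ => congrArg (fun t => ρ i * (_ - t)) (hp i)
      _ = ∑ i, ρ i * (X i).gauge ((p.1 i).2, (p.2 i).2) - Y.gauge ((p.1 i₀).1, (p.2 i₀).1) := by
          simp_rw [mul_sub, Finset.sum_sub_distrib, ← Finset.sum_mul, hρ, one_mul]
  exact TangentRep.toTangent_eq_of_pull_ae_eq (ω := (P : Measure (∀ i, Y × X i))) (a := id)
    (b := shareBase Y X i₀) (MeasurePreserving.id _) ⟨measurable_shareBase i₀, rfl⟩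
    (ae_eq_refl _) hmean

end Lifts

end GromovWasserstein

theorem theorem5p3_general {N : ℕ} (ρ : Fin N → ℝ) (hρ : ρ ∈ stdSimplex ℝ (Fin N))
    (Y : GMSpace.{u}) (X : Fin N → GMSpace.{u}) (π : ∀ i, Measure (Y × X i))
    (hπ : ∀ i, IsPlan Y (X i) (π i)) :
    ∃ (π' : ∀ i, Measure (Y × X i)) (hπ' : ∀ i, IsPlan Y (X i) (π' i))
      (γ : Measure (Y × (∀ i, X i))) (hγ : IsGluing Y X π' γ),
      (∀ i, ∃ σ, IsOptimal Y Y σ ∧ π' i ∈ meltings Y Y (X i) σ (π i)) ∧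
      IsTangentialBarycenter ρ (fun i => lift Y (X i) (π i) (hπ i))
        (meanTangent Y X ρ π' hπ' γ hγ) := by
  obtain ⟨i₀⟩ := nonempty_of_mem_stdSimplex hρ
  obtain ⟨P, hP, hmin⟩ := exists_isMinOn_dispersion hρ
    (f := fun i => liftRep Y (X i) (π i) (hπ i))
  refine ⟨sharedPlan i₀ P, isPlan_sharedPlan hP i₀, _, isGluing_map_shareBase hP i₀,
    exists_isOptimal_sharedPlan_mem_meltings hP i₀, ?_⟩
  rw [← toTangent_meanRep_liftRep hρ.2 i₀ hP]
  exact isTangentialBarycenter_meanRep hρ i₀ hP hmin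

theorem theorem5p3 {N : ℕ} (ρ : Fin N → ℝ) (hρ : ρ ∈ stdSimplex ℝ (Fin N))
    (Y : GMSpace.{u}) (X : Fin N → GMSpace.{u})
    (π : ∀ i, Measure (Y × X i)) (hπ : ∀ i, IsOptimal Y (X i) (π i)) :
    (∃ 𝔣 : TangentSpace Y.toClass,
      IsTangentialBarycenter ρ (fun i => lift Y (X i) (π i) (hπ i).isPlan) 𝔣) ∧
    ∃ (π' : ∀ i, Measure (Y × X i)) (hπ' : ∀ i, PlanEquiv Y (X i) (π' i) (π i))
      (γ : Measure (Y × (∀ i, X i))) (hγ : IsGluing Y X π' γ),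
      IsTangentialBarycenter ρ (fun i => lift Y (X i) (π i) (hπ i).isPlan)
        (meanTangent Y X ρ π' (fun i => (hπ' i).left.isPlan) γ hγ) := by
  obtain ⟨π', _, γ, hγ, hmelt, h⟩ := theorem5p3_general ρ hρ Y X π fun i => (hπ i).isPlan
  exact ⟨⟨_, h⟩, π', fun i => (hmelt i).elim fun _ hσ =>
    planEquiv_of_mem_meltings hσ.1 (hπ i) hσ.2, γ, hγ, h⟩
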